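/- **Setting.** A total-reward Markov decision process (MDP) has non-terminal states $0,\dots,N-1$, a terminal state (sink) $N$ of value $0$, and $m$ actions. Each action $a$ belongs to exactly one non-terminal state, each non-terminal state has at least one action, and $a$ has a reward $c_a\in\mathbb R$ and transition probabilities $p(t\mid a)\ge 0$, $\sum_{t=0}^{N}p(t\mid a)=1$. It is *stopping* if under every positional policy the sink is reachable from every state. Let $J,P\in\mathbb R^{m\times N}$, where $J_{a,i}=1$ if $a$ belongs to state $i$ and $J_{a,i}=0$ otherwise, and $P_{a,i}=p(i\mid a)$. The *MDP-derived LP*, of dimension $N$ with $m$ constraints, is $$\text{minimize } \mathbf e^{T}y\quad\text{subject to}\quad (J-P)\,y\ge c ,\qquad \mathbf e=(1,\dots,1)^T .$$ The simplex method is run, as usual for LPs of MDPs, on its dual in standard form, $\max\{c^Tx : (J-P)^Tx=\mathbf e,\ x\ge 0\}$, from a given initial feasible basis. Under *Dantzig's pivot rule* the entering variable is one with the largest reduced cost (which has to be positive) and the leaving variable is chosen by the ratio test; ties are broken arbitrarily. The method stops when no reduced cost is positive or when the column of the entering variable certifies unboundedness. An *MDP-smoothed perturbation* of radius $\sigma$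 of an MDP is an MDP with the same $J$ in which zero transition probabilities and zero rewards stay zero, every reward changes by at most $\sigma$, and, for every action $a$, each nonzero probability $p(t\mid a)$, except the one of the first state $t$ with $p(t\mid a)\ne 0$, changes by at most $\sigma$; that first probability is one minus the sum of the others. (So probabilities equal to one stay one.) **Theorem.** The worst-case MDP-smoothed complexity of the simplex method with Dantzig's pivot rule, for MDP-derived LPs of dimension $N$ with $O(N)$ constraints and perturbations of up to $1/\Omega(N)$, is $2^{\Omega(\sqrt N)}$. Precisely: there are constants $C,c>0$ such that for every $K>0$ and all sufficiently large $N$ there are a stopping MDP with $N$ non-terminal states, at most $CN$ actions and all rewards in $[-1,1]$, and an initial basis $\beta_0$, such that: 1. for **every** MDP-smoothed perturbation of radius $K/N$ of this MDP, $\beta_0$ is a feasible basis for the perturbed LP, and the simplex method with Dantzig's pivot rule started at $\beta_0$ makes at least $2^{c\sqrt N}$ pivots, however ties are broken; 2. consequently, for **every** probability distribution on the MDP-smoothed perturbations of radius $K/N$, the expected number of pivots is at least $2^{c\sqrt N}$. -/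

import Mathlib

open scoped Matrix ENNReal

noncomputable section

/-- A finite total-reward Markov decision process with `N` non-terminal states `0, …, N - 1`, one
terminal state (sink) `Fin.last N`, at which the process stops with value `0`, and `m` actions.
The non-terminal state `s` is the element `s.castSucc` of `Fin (N + 1)`. -/
structure TotalRewardMDP (N m : ℕ) where
  /-- the state at which an action is available -/
  src : Fin m → Fin N
  /-- `prob a t` is the probability of ending up in `t` when action `a` is taken -/
  prob : Fin m → Fin (N + 1) → ℝ
  /-- the reward of an action -/
  reward : Fin m → ℝ
  prob_nonneg : ∀ a t, 0 ≤ prob a t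
  prob_sum : ∀ a, ∑ t, prob a t = 1
  /-- every non-terminal state has an action -/
  src_surjective : Function.Surjective src

/-- A linear program in inequality form: minimize `obj ⬝ y` over `y ∈ ℝ^N` subject to
the `m` constraints `mat *ᵥ y ≥ rhs`. -/
structure InequalityLP (N m : ℕ) where
  mat : Matrix (Fin m) (Fin N) ℝ
  rhs : Fin m → ℝ
  obj : Fin N → ℝ

namespace TotalRewardMDP

variable {N m : ℕ}

/-- A positional policy selects at every non-terminal state an action available there. -/
def IsPolicy (M : TotalRewardMDP N m) (π : Fin N → Fin m) : Prop :=
  ∀ s, M.src (π s) = s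

/-- The edges of the Markov chain induced by `π`. -/
def Edge (M : TotalRewardMDP N m) (π : Fin N → Fin m) (u v : Fin (N + 1)) : Prop :=
  ∃ s : Fin N, u = s.castSucc ∧ 0 < M.prob (π s) v

/-- One must eventually reach the sink: under every policy, the sink is reachable from every
state (equivalently, it is reached with probability one), so that total rewards are
well-defined. -/
def Stopping (M : TotalRewardMDP N m) : Prop :=
  ∀ π, M.IsPolicy π → ∀ u, Relation.ReflTransGen (M.Edge π) u (Fin.last N)

/-- The matrix `J`: `J a i = 1` if action `a` is available at state `i`, and `0` otherwise. -/
def adj (M : TotalRewardMDP N m) : Matrix (Fin m) (Fin N) ℝ :=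
  Matrix.of fun a i => if M.src a = i then 1 else 0

/-- The matrix `P` of transition probabilities between non-terminal states. -/
def trans (M : TotalRewardMDP N m) : Matrix (Fin m) (Fin N) ℝ :=
  Matrix.of fun a i => M.prob a i.castSucc

/-- The linear program of the MDP: minimize `𝐞ᵀ y` subject to `(J - P) y ≥ c`. -/
def lp (M : TotalRewardMDP N m) : InequalityLP N m where
  mat := M.adj - M.trans
  rhs := M.reward
  obj := fun _ => 1

/-- `M'` arises from `M` by an admissible (structure-preserving) perturbation of radius `σ`:
the adjacency matrix is not perturbed; zero probabilities stay zero (hence probabilities equal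
to one stay one, because each row sums to one); for each action, every nonzero probability
other than the one of the first state with nonzero probability is perturbed by at most `σ`, and
that first probability is then determined as one minus the sum of the others; the nonzero
rewards are perturbed by at most `σ`, and zero rewards stay zero. -/
structure IsPerturbation (M : TotalRewardMDP N m) (σ : ℝ) (M' : TotalRewardMDP N m) : Prop where
  src_eq : M'.src = M.src
  prob_zero : ∀ a t, M.prob a t = 0 → M'.prob a t = 0
  prob_close : ∀ a t, (∃ u, u < t ∧ M.prob a u ≠ 0) → |M'.prob a t - M.prob a t| ≤ σ
  reward_zero : ∀ a, M.reward a = 0 → M'.reward a = 0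
  reward_close : ∀ a, |M'.reward a - M.reward a| ≤ σ

end TotalRewardMDP

/-! The simplex method for a linear program `min obj ⬝ y, mat *ᵥ y ≥ rhs` is run, as is standard
for linear programs of MDPs, on its dual in standard form
`max rhs ⬝ x` subject to `matᵀ *ᵥ x = obj, x ≥ 0`, which has `N` equations and `m` variables.
A basis is given by listing its `N` basic variables. -/

namespace InequalityLP

variable {N m : ℕ}

/-- The `N × N` matrix of the basic columns. -/
def basisMatrix (L : InequalityLP N m) (β : Fin N → Fin m) : Matrix (Fin N) (Fin N) ℝ :=
  L.matᵀ.submatrix id β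

/-- The values of the basic variables in the basic solution of `β`. -/
def basicSolution (L : InequalityLP N m) (β : Fin N → Fin m) : Fin N → ℝ :=
  (L.basisMatrix β)⁻¹ *ᵥ L.obj

/-- `β` is a basis and its basic solution is feasible. -/
def IsFeasibleBasis (L : InequalityLP N m) (β : Fin N → Fin m) : Prop :=
  IsUnit (L.basisMatrix β).det ∧ ∀ r, 0 ≤ L.basicSolution β r

/-- The column of variable `j` expressed in the basis `β`. -/
def tableauColumn (L : InequalityLP N m) (β : Fin N → Fin m) (j : Fin m) : Fin N → ℝ :=
  (L.basisMatrix β)⁻¹ *ᵥ L.mat j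

/-- The reduced cost of variable `j`: the rate of change of the objective when `j` increases. -/
def reducedCost (L : InequalityLP N m) (β : Fin N → Fin m) (j : Fin m) : ℝ :=
  L.rhs j - (fun r => L.rhs (β r)) ⬝ᵥ L.tableauColumn β j

/-- Dantzig's rule: the entering variable has the largest reduced cost, which is positive. -/
def IsEntering (L : InequalityLP N m) (β : Fin N → Fin m) (j : Fin m) : Prop :=
  0 < L.reducedCost β j ∧ ∀ j', L.reducedCost β j' ≤ L.reducedCost β j

/-- The ratio test for the position `r` of the leaving variable when `j` enters. -/
def IsLeaving (L : InequalityLP N m) (β : Fin N → Fin m) (j : Fin m) (r : Fin N) : Prop :=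
  0 < L.tableauColumn β j r ∧ ∀ r', 0 < L.tableauColumn β j r' →
    L.basicSolution β r / L.tableauColumn β j r ≤ L.basicSolution β r' / L.tableauColumn β j r'

/-- `β'` results from `β` by one pivot of the simplex method with Dantzig's rule; ties are
broken arbitrarily. -/
def DantzigPivot (L : InequalityLP N m) (β β' : Fin N → Fin m) : Prop :=
  ∃ j r, L.IsEntering β j ∧ L.IsLeaving β j r ∧ β' = Function.update β r j

/-- The method may stop at `β`: no reduced cost is positive (`β` is optimal), or the column of
an entering variable certifies unboundedness. -/
def Halts (L : InequalityLP N m) (β : Fin N → Fin m) : Prop :=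
  (∀ j, L.reducedCost β j ≤ 0) ∨ ∃ j, L.IsEntering β j ∧ ∀ r, L.tableauColumn β j r ≤ 0

/-- `β 0, …, β k` is a complete run of the simplex method with Dantzig's rule with `k` pivots,
started at `β₀`. -/
def IsRun (L : InequalityLP N m) (β₀ : Fin N → Fin m) (k : ℕ) (β : ℕ → Fin N → Fin m) : Prop :=
  β 0 = β₀ ∧ (∀ i < k, L.DantzigPivot (β i) (β (i + 1))) ∧ L.Halts (β k)

/-- The number of pivots of the simplex method with Dantzig's rule started at `β₀`, under the
most favourable breaking of ties (`⊤` if no run ends). -/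
def pivotCount (L : InequalityLP N m) (β₀ : Fin N → Fin m) : ℕ∞ :=
  ⨅ (k : ℕ) (_ : ∃ β, L.IsRun β₀ k β), (k : ℕ∞)

end InequalityLP

end

/-! A stopping MDP turns the simplex method into policy iteration on one state at a time: feasible
bases reached from a policy are policies, and the entering action replaces the current action at its
own state (`eq_src_of_isLeaving`). The MDP is a Klee-Minty cube with `n` levels. The decision state
of level `i + 1` copies one of the two main states of level `i`, and the averaging state mixes them
by a coin, so the sign of the difference of the two values depends only on the parity of the choices
below. Switching choice `i` pays off exactly when the parity of the first `i + 1` bits is odd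
(`pairValue_not_sub`). Always switching the highest profitable level counts down in the reflected
Gray code, which takes `2 ^ n - 1` pivots.

Dantzig's rule has to prefer high levels although the value gaps shrink like `2 ^ (-i)`. Hence a
choice at level `i` leads through a chain with `2 * (n - i)` coin tosses, each failure returning to
the decision state. This leaves the values of the policy unchanged and scales the advantage of the
unused choice by about `4 ^ (-(n - i))`. The resulting `2 ^ (i - 2 * n)` doubles from level to
level.

Only coins near one half occur. Errors of order `K / N` in at most `3 * n` factors, with `n` of
order `√N`, cost less than the factor two between levels (`scaled_gap_lt`), so every admissible
perturbation follows the same path. The chains need about `4 * n ^ 2` states, whence the exponent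
`√N`. -/

namespace InequalityLP

variable {N m : ℕ}

/-- Reduced costs expressed through the dual solution of the basis. -/
theorem reducedCost_eq (L : InequalityLP N m) {β : Fin N → Fin m}
    (hβ : IsUnit (L.basisMatrix β).det) {v : Fin N → ℝ}
    (hv : ∀ r, (L.mat *ᵥ v) (β r) = L.rhs (β r)) (j : Fin m) :
    L.reducedCost β j = L.rhs j - (L.mat *ᵥ v) j := by
  have hrhs : (fun r => L.rhs (β r)) = v ᵥ* L.basisMatrix β := by
    funext r
    rw [← hv r]
    simp [Matrix.mulVec, Matrix.vecMul, dotProduct, basisMatrix, mul_comm]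
  unfold reducedCost tableauColumn
  rw [hrhs, Matrix.dotProduct_mulVec, Matrix.vecMul_vecMul, Matrix.mul_nonsing_inv _ hβ,
    Matrix.vecMul_one, dotProduct_comm]
  rfl

end InequalityLP

/-! ### Simplex pivots on a stopping MDP as policy switches. -/

namespace TotalRewardMDP

variable {N m : ℕ}

theorem lp_mulVec (M : TotalRewardMDP N m) (v : Fin N → ℝ) (a : Fin m) :
    (M.lp.mat *ᵥ v) a = v (M.src a) - ∑ t, M.prob a t * Fin.snoc (α := fun _ => ℝ) v 0 t := by
  simp only [lp, Matrix.sub_mulVec, Pi.sub_apply, Fin.sum_univ_castSucc, Fin.snoc_castSucc,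
    Fin.snoc_last, mul_zero, add_zero]
  simp [Matrix.mulVec, dotProduct, adj, trans]

/-- The maximum principle for stopping processes. -/
theorem nonneg_of_lp_mulVec_nonneg {M : TotalRewardMDP N m} (hM : M.Stopping)
    {π : Fin N → Fin m} (hπ : M.IsPolicy π) {v : Fin N → ℝ}
    (hv : ∀ s, 0 ≤ (M.lp.mat *ᵥ v) (π s)) (s : Fin N) : 0 ≤ v s := by
  set w : Fin (N + 1) → ℝ := Fin.snoc (α := fun _ => ℝ) v 0 with hw
  obtain ⟨u, hu⟩ := Finite.exists_min w
  -- At a minimum of `w` the mean of the nonnegative `w t - w u` over the successors is nonpositive,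
  -- so minimality spreads along edges until it reaches the sink, where `w` is zero.
  have key : ∀ x, Relation.ReflTransGen (M.Edge π) u x → w x = w u := by
    intro x hx
    induction hx with
    | refl => rfl
    | tail _ hyz ih =>
      rename_i y z _
      obtain ⟨s, rfl, hpos⟩ := hyz
      have h1 := hv s
      rw [lp_mulVec, hπ s, ← hw] at h1
      have h2 : v s = w u := by rw [← ih, hw, Fin.snoc_castSucc]
      have h3 : ∑ t, M.prob (π s) t * (w t - w u) ≤ 0 := by
        simp only [mul_sub, Finset.sum_sub_distrib, ← Finset.sum_mul, M.prob_sum]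
        linarith
      have h4 : M.prob (π s) z * (w z - w u) ≤ 0 :=
        (Finset.single_le_sum (f := fun t => M.prob (π s) t * (w t - w u))
          (fun t _ => mul_nonneg (M.prob_nonneg _ _) (sub_nonneg.2 (hu t)))
          (Finset.mem_univ z)).trans h3
      have h5 : w z - w u ≤ 0 := by
        by_contra h
        exact absurd h4 (not_le.2 (mul_pos hpos (not_le.1 h)))
      linarith [hu z]
  have h0 := key _ (hM π hπ u)
  have h1 := hu s.castSucc
  rw [← h0, hw, Fin.snoc_last, Fin.snoc_castSucc] at h1
  exact h1

/-- The maximum principle applied to both differences of two vectors with equal image gives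
injectivity of the transpose. -/
theorem isUnit_det_basisMatrix {M : TotalRewardMDP N m} (hM : M.Stopping)
    {π : Fin N → Fin m} (hπ : M.IsPolicy π) : IsUnit (M.lp.basisMatrix π).det := by
  rw [← Matrix.det_transpose, ← Matrix.isUnit_iff_isUnit_det, ← Matrix.mulVec_injective_iff_isUnit]
  intro v w hvw
  have key : ∀ v w : Fin N → ℝ, (M.lp.basisMatrix π)ᵀ *ᵥ v = (M.lp.basisMatrix π)ᵀ *ᵥ w →
      ∀ s, v s ≤ w s := by
    intro v w h s
    have := nonneg_of_lp_mulVec_nonneg hM hπ (v := w - v) (fun s => by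
      have := congrFun h s
      rw [Matrix.mulVec_sub, Pi.sub_apply]
      exact sub_nonneg.2 this.le) s
    simpa using this
  exact funext fun s => le_antisymm (key v w hvw s) (key w v hvw.symm s)

theorem basisMatrix_mulVec (M : TotalRewardMDP N m) {π : Fin N → Fin m} (hπ : M.IsPolicy π)
    (x : Fin N → ℝ) (i : Fin N) :
    (M.lp.basisMatrix π *ᵥ x) i = x i - ∑ s, M.prob (π s) i.castSucc * x s := by
  have h : ∀ s, M.src (π s) = s := hπ
  simp [Matrix.mulVec, dotProduct, InequalityLP.basisMatrix, lp, adj, trans, sub_mul, h]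

/-- The basic solution of a policy is nonnegative (it counts expected visits). -/
theorem basicSolution_nonneg {M : TotalRewardMDP N m} (hM : M.Stopping)
    {π : Fin N → Fin m} (hπ : M.IsPolicy π) (r : Fin N) : 0 ≤ M.lp.basicSolution π r := by
  have hdet := isUnit_det_basisMatrix hM hπ
  unfold InequalityLP.basicSolution
  rw [Matrix.mulVec, dotProduct]
  refine Finset.sum_nonneg fun i _ => mul_nonneg ?_ (show (0 : ℝ) ≤ M.lp.obj i from zero_le_one)
  -- Each row of the inverse solves the policy's equations with a unit vector on the right, so the
  -- maximum principle makes it nonnegative.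
  have h := nonneg_of_lp_mulVec_nonneg hM hπ (v := fun i => (M.lp.basisMatrix π)⁻¹ r i) ?_ i
  · exact h
  · intro s
    have : (M.lp.mat *ᵥ fun i => (M.lp.basisMatrix π)⁻¹ r i) (π s)
        = ((M.lp.basisMatrix π)⁻¹ * M.lp.basisMatrix π) r s := by
      simp [Matrix.mulVec, dotProduct, Matrix.mul_apply, InequalityLP.basisMatrix, mul_comm]
    rw [this, Matrix.nonsing_inv_mul _ hdet, Matrix.one_apply]
    split_ifs <;> simp

theorem isFeasibleBasis {M : TotalRewardMDP N m} (hM : M.Stopping)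
    {π : Fin N → Fin m} (hπ : M.IsPolicy π) : M.lp.IsFeasibleBasis π :=
  ⟨isUnit_det_basisMatrix hM hπ, basicSolution_nonneg hM hπ⟩

theorem basisMatrix_mulVec_basicSolution {M : TotalRewardMDP N m} (hM : M.Stopping)
    {π : Fin N → Fin m} (hπ : M.IsPolicy π) :
    M.lp.basisMatrix π *ᵥ M.lp.basicSolution π = fun _ => 1 := by
  unfold InequalityLP.basicSolution
  rw [Matrix.mulVec_mulVec, Matrix.mul_nonsing_inv _ (isUnit_det_basisMatrix hM hπ),
    Matrix.one_mulVec]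
  rfl

theorem basisMatrix_mulVec_tableauColumn {M : TotalRewardMDP N m} (hM : M.Stopping)
    {π : Fin N → Fin m} (hπ : M.IsPolicy π) (j : Fin m) :
    M.lp.basisMatrix π *ᵥ M.lp.tableauColumn π j = M.lp.mat j := by
  unfold InequalityLP.tableauColumn
  rw [Matrix.mulVec_mulVec, Matrix.mul_nonsing_inv _ (isUnit_det_basisMatrix hM hπ),
    Matrix.one_mulVec]

/-- The leaving variable is the current action at the state of the entering action. -/
theorem eq_src_of_isLeaving {M : TotalRewardMDP N m} (hM : M.Stopping)
    {π : Fin N → Fin m} (hπ : M.IsPolicy π) {j : Fin m} {r : Fin N}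
    (h : M.lp.IsLeaving π j r) : r = M.src j := by
  by_contra hr
  obtain ⟨hd, hmin⟩ := h
  set x := M.lp.basicSolution π with hx
  set d := M.lp.tableauColumn π j with hd'
  have hx0 : ∀ i, 0 ≤ x i := basicSolution_nonneg hM hπ
  set θ := x r / d r with hθ
  have hθ0 : 0 ≤ θ := div_nonneg (hx0 r) hd.le
  have hy : ∀ i, 0 ≤ (x - θ • d) i := by
    intro i
    simp only [Pi.sub_apply, Pi.smul_apply, smul_eq_mul]
    rcases le_or_gt (d i) 0 with h | h
    · nlinarith [hx0 i]
    · have := (le_div_iff₀ h).1 (hmin i h)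
      linarith
  have hyr : (x - θ • d) r = 0 := by
    simp only [Pi.sub_apply, Pi.smul_apply, smul_eq_mul, hθ]
    field_simp
    ring
  -- Flow balance at `r` after the pivot: the flow `x - θ • d` vanishes at `r`, yet if `j` belongs
  -- to another state, then `r` must carry at least its unit of inflow.
  have h1 := basisMatrix_mulVec M hπ (x - θ • d) r
  rw [Matrix.mulVec_sub, Matrix.mulVec_smul, hx, hd', basisMatrix_mulVec_basicSolution hM hπ,
    basisMatrix_mulVec_tableauColumn hM hπ, ← hx, ← hd', hyr] at h1
  have h2 : M.lp.mat j r = - M.prob j r.castSucc := by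
    simp [lp, adj, trans, Ne.symm hr]
  have h3 : 0 ≤ ∑ s, M.prob (π s) r.castSucc * (x - θ • d) s :=
    Finset.sum_nonneg fun s _ => mul_nonneg (M.prob_nonneg _ _) (hy s)
  simp only [Pi.sub_apply, Pi.smul_apply, smul_eq_mul, h2] at h1 h3
  nlinarith [mul_nonneg hθ0 (M.prob_nonneg j r.castSucc)]

theorem IsPolicy.update {M : TotalRewardMDP N m} {π : Fin N → Fin m} (hπ : M.IsPolicy π)
    (j : Fin m) : M.IsPolicy (Function.update π (M.src j) j) := by
  intro s
  by_cases h : s = M.src j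
  · subst h; simp
  · simp [Function.update_of_ne h, hπ s]

/-- The column of an action has a positive entry at its own state. -/
theorem tableauColumn_src_pos {M : TotalRewardMDP N m} (hM : M.Stopping)
    {π : Fin N → Fin m} (hπ : M.IsPolicy π) (j : Fin m) :
    0 < M.lp.tableauColumn π j (M.src j) := by
  set d := M.lp.tableauColumn π j with hd
  set s := M.src j with hs
  set π' := Function.update π s j with hπ'
  have hp' : M.IsPolicy π' := hπ.update j
  -- `h i` is the expected number of visits to `s` from `i` under the switched policy `π'`.
  set h : Fin N → ℝ := fun i => (M.lp.basisMatrix π')⁻¹ s i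
  have hh : ∀ t, (M.lp.mat *ᵥ h) (π' t) = (1 : Matrix (Fin N) (Fin N) ℝ) s t := by
    intro t
    rw [← Matrix.nonsing_inv_mul _ (isUnit_det_basisMatrix hM hp')]
    simp [h, Matrix.mulVec, dotProduct, Matrix.mul_apply, InequalityLP.basisMatrix, mul_comm]
  have hh0 : ∀ i, 0 ≤ h i := nonneg_of_lp_mulVec_nonneg hM hp' fun t => by
    rw [hh, Matrix.one_apply]; split_ifs <;> simp
  have hj : (M.lp.mat *ᵥ h) j = 1 := by simpa [hπ'] using hh s
  have hne : ∀ t, t ≠ s → (M.lp.mat *ᵥ h) (π t) = 0 := by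
    intro t ht
    have := hh t
    rw [hπ', Function.update_of_ne ht, Matrix.one_apply_ne (Ne.symm ht)] at this
    exact this
  have hprod : (M.lp.mat *ᵥ h) (π s) * d s = 1 := by
    have h1 : h ⬝ᵥ (M.lp.basisMatrix π *ᵥ d) = 1 := by
      rw [hd, basisMatrix_mulVec_tableauColumn hM hπ, dotProduct_comm]
      exact hj
    rw [Matrix.dotProduct_mulVec] at h1
    have h2 : h ᵥ* M.lp.basisMatrix π = fun t => (M.lp.mat *ᵥ h) (π t) := by
      funext t
      simp [Matrix.mulVec, Matrix.vecMul, dotProduct, InequalityLP.basisMatrix, mul_comm]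
    rw [h2, dotProduct, Finset.sum_eq_single s (fun t _ ht => by rw [hne t ht, zero_mul])
      (fun h => absurd (Finset.mem_univ _) h)] at h1
    exact h1
  by_contra hneg
  have hle : (M.lp.mat *ᵥ h) (π s) ≤ 0 := by
    by_contra hc
    nlinarith [not_lt.1 hneg, not_le.1 hc]
  -- With a nonpositive residual at `s` and zero residuals elsewhere, `-h` meets the maximum
  -- principle for `π`, so `h ≤ 0`.
  have hzero : h = 0 := by
    funext i
    refine le_antisymm ?_ (hh0 i)
    have := nonneg_of_lp_mulVec_nonneg hM hπ (v := -h) (fun t => by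
      rw [Matrix.mulVec_neg, Pi.neg_apply]
      by_cases ht : t = s
      · rw [ht]; linarith
      · rw [hne t ht, neg_zero]) i
    simpa using this
  rw [hzero, Matrix.mulVec_zero] at hj
  exact zero_ne_one hj

theorem eq_update_of_dantzigPivot {M : TotalRewardMDP N m} (hM : M.Stopping)
    {π π' : Fin N → Fin m} (hπ : M.IsPolicy π) (h : M.lp.DantzigPivot π π') :
    ∃ j, M.lp.IsEntering π j ∧ π' = Function.update π (M.src j) j := by
  obtain ⟨j, r, hj, hr, rfl⟩ := h
  exact ⟨j, hj, by rw [eq_src_of_isLeaving hM hπ hr]⟩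

/-- Linear programs of stopping processes are bounded: the method stops only at optimal bases. -/
theorem reducedCost_nonpos_of_halts {M : TotalRewardMDP N m} (hM : M.Stopping)
    {π : Fin N → Fin m} (hπ : M.IsPolicy π) (h : M.lp.Halts π) (j : Fin m) :
    M.lp.reducedCost π j ≤ 0 := by
  rcases h with h | ⟨i, _, hi⟩
  · exact h j
  · exact absurd (hi _) (not_le.2 (tableauColumn_src_pos hM hπ i))

end TotalRewardMDP

/-! ### Coin-flip processes and their perturbations. -/

namespace TotalRewardMDP

variable {N m : ℕ}

/-- The decision process in which every action moves to one of two states, each with probability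
one half. -/
noncomputable def coinFlip (src : Fin m → Fin N) (hsrc : Function.Surjective src)
    (t₁ t₂ : Fin m → Fin (N + 1)) (reward : Fin m → ℝ) : TotalRewardMDP N m where
  src := src
  prob a t := (if t = t₁ a then 1 / 2 else 0) + (if t = t₂ a then 1 / 2 else 0)
  reward := reward
  prob_nonneg a t := by split_ifs <;> norm_num
  prob_sum a := by simp [Finset.sum_add_distrib]; norm_num
  src_surjective := hsrc

/-- A perturbed process flips biased coins. -/
theorem exists_bias_of_isPerturbation {src : Fin m → Fin N} {hsrc : Function.Surjective src}
    {t₁ t₂ : Fin m → Fin (N + 1)} {reward : Fin m → ℝ} {σ : ℝ} (hσ : 0 ≤ σ)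
    {M' : TotalRewardMDP N m} (h : (coinFlip src hsrc t₁ t₂ reward).IsPerturbation σ M')
    (a : Fin m) : ∃ q : ℝ, |q - 1 / 2| ≤ σ ∧ (∀ f : Fin (N + 1) → ℝ,
      ∑ t, M'.prob a t * f t = q * f (t₁ a) + (1 - q) * f (t₂ a)) := by
  have hz : ∀ t, t ≠ t₁ a → t ≠ t₂ a → M'.prob a t = 0 := fun t h1 h2 =>
    h.prob_zero a t (by simp [coinFlip, h1, h2])
  have hsum := M'.prob_sum a
  by_cases heq : t₁ a = t₂ a
  -- With coinciding successors any bias represents the action; one half satisfies the bound.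
  · refine ⟨1 / 2, by simpa using hσ, fun f => ?_⟩
    have hz' : ∀ t, t ≠ t₁ a → M'.prob a t = 0 := fun t ht => hz t ht (heq ▸ ht)
    rw [Finset.sum_eq_single (t₁ a) (fun t _ ht => hz' t ht) (by simp)] at hsum
    rw [Finset.sum_eq_single (t₁ a) (fun t _ ht => by rw [hz' t ht, zero_mul]) (by simp), hsum,
      ← heq]
    ring
  · have key : ∀ f : Fin (N + 1) → ℝ,
        ∑ t, M'.prob a t * f t = M'.prob a (t₁ a) * f (t₁ a) + M'.prob a (t₂ a) * f (t₂ a) := by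
      intro f
      refine Fintype.sum_eq_add _ _ heq fun t ht => ?_
      rw [hz t ht.1 ht.2, zero_mul]
    have hone := key fun _ => 1
    simp only [mul_one, hsum] at hone
    have h1 : (coinFlip src hsrc t₁ t₂ reward).prob a (t₁ a) = 1 / 2 := by
      simp [coinFlip, heq]
    have h2 : (coinFlip src hsrc t₁ t₂ reward).prob a (t₂ a) = 1 / 2 := by
      simp [coinFlip, Ne.symm heq]
    refine ⟨M'.prob a (t₁ a), ?_, fun f => ?_⟩
    -- Closeness is assumed only for the successor of larger index; the other probability is its
    -- complement and moves equally far.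
    · rcases lt_or_gt_of_ne heq with hlt | hlt
      · have := h.prob_close a (t₂ a) ⟨t₁ a, hlt, by rw [h1]; norm_num⟩
        rw [h2, abs_sub_comm] at this
        rwa [show M'.prob a (t₁ a) - 1 / 2 = 1 / 2 - M'.prob a (t₂ a) by linarith]
      · have := h.prob_close a (t₁ a) ⟨t₂ a, hlt, by rw [h2]; norm_num⟩
        rwa [h1] at this
    · rw [key, show 1 - M'.prob a (t₁ a) = M'.prob a (t₂ a) by linarith]

/-- Perturbations of radius less than one half preserve the edges, hence stopping. -/
theorem stopping_of_isPerturbation_coinFlip {src : Fin m → Fin N} {hsrc : Function.Surjective src}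
    {t₁ t₂ : Fin m → Fin (N + 1)} {reward : Fin m → ℝ} {σ : ℝ} (hσ : 0 ≤ σ) (hσ' : σ < 1 / 2)
    (hM : (coinFlip src hsrc t₁ t₂ reward).Stopping)
    {M' : TotalRewardMDP N m} (h : (coinFlip src hsrc t₁ t₂ reward).IsPerturbation σ M') :
    M'.Stopping := by
  intro π hπ u
  refine Relation.ReflTransGen.mono ?_ _ _
    (hM π (fun s => (congrFun h.src_eq (π s)).symm.trans (hπ s)) u)
  rintro x y ⟨s, rfl, hs⟩
  refine ⟨s, rfl, ?_⟩
  obtain ⟨q, hq, hf⟩ := exists_bias_of_isPerturbation hσ h (π s)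
  have hfy := hf fun t => if t = y then 1 else 0
  simp only [mul_ite, mul_one, mul_zero, Finset.sum_ite_eq', Finset.mem_univ, if_true] at hfy
  rw [hfy]
  obtain ⟨hq1, hq2⟩ := abs_le.1 hq
  by_cases h1 : t₁ (π s) = y <;> by_cases h2 : t₂ (π s) = y
  · simp [h1, h2]
  · simp [h1, h2]; linarith
  · simp [h1, h2]; linarith
  · simp [coinFlip, Ne.symm h1, Ne.symm h2] at hs

end TotalRewardMDP

/-! ### Gray code countdown. -/

namespace KleeMinty

/-- The parity of the first `i` bits. -/
def parity (b : ℕ → Bool) : ℕ → Bool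
  | 0 => false
  | i + 1 => xor (parity b i) (b i)

/-- The number whose binary digits, most significant first, are `parity b 1, …, parity b n`;
thus `b` is its reflected Gray code. -/
def grayRank (b : ℕ → Bool) : ℕ → ℕ
  | 0 => 0
  | i + 1 => 2 * grayRank b i + (parity b (i + 1)).toNat

/-- Flip the bit `i`. -/
def flip (b : ℕ → Bool) (i : ℕ) : ℕ → Bool := Function.update b i (!b i)

theorem parity_flip_of_le (b : ℕ → Bool) {i j : ℕ} (h : j ≤ i) :
    parity (flip b i) j = parity b j := by
  induction j with
  | zero => rfl
  | succ j ih =>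
    rw [parity, parity, ih (by omega), flip, Function.update_of_ne (by omega)]

theorem parity_flip_of_lt (b : ℕ → Bool) {i j : ℕ} (h : i < j) :
    parity (flip b i) j = !parity b j := by
  induction j with
  | zero => omega
  | succ j ih =>
    rcases (Nat.lt_succ_iff.1 h).eq_or_lt with rfl | h'
    · rw [parity, parity, parity_flip_of_le b le_rfl, flip, Function.update_self]
      simp
    · rw [parity, parity, ih h', flip, Function.update_of_ne (by omega)]
      simp

/-- Flipping the last bit with odd parity decrements the rank. -/
theorem grayRank_flip (b : ℕ → Bool) {i n : ℕ} (hi : i < n) (hp : parity b (i + 1) = true)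
    (hn : ∀ j, i < j → j < n → parity b (j + 1) = false) :
    grayRank (flip b i) n + 1 = grayRank b n := by
  have hle : ∀ j ≤ i, grayRank (flip b i) j = grayRank b j := by
    intro j hj
    induction j with
    | zero => rfl
    | succ j ih => rw [grayRank, grayRank, ih (by omega), parity_flip_of_le b hj]
  induction n, hi using Nat.le_induction with
  | base =>
    rw [grayRank, grayRank, hle i le_rfl, parity_flip_of_lt b (by omega), hp]
    simp
  -- Past position `i` all digits turn from 0 to 1, as in a binary borrow.
  | succ n hin ih =>
    have h1 := ih fun j h1 h2 => hn j h1 (by omega)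
    rw [grayRank, grayRank, parity_flip_of_lt b (by omega), hn n (by omega) (by omega)]
    simp only [Bool.not_false, Bool.toNat_true, Bool.toNat_false]
    omega

theorem grayRank_eq_zero {b : ℕ → Bool} {n : ℕ} (h : ∀ i < n, parity b (i + 1) = false) :
    grayRank b n = 0 := by
  induction n with
  | zero => rfl
  | succ n ih =>
    rw [grayRank, ih fun i hi => h i (by omega), h n (by omega)]
    rfl

/-- The bits of largest rank. -/
def startBits (i : ℕ) : Bool := i == 0

theorem parity_startBits (i : ℕ) : parity startBits (i + 1) = true := by
  induction i with
  | zero => rfl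
  | succ i ih => rw [parity, ih]; simp [startBits]

theorem grayRank_startBits (n : ℕ) : grayRank startBits n + 1 = 2 ^ n := by
  induction n with
  | zero => rfl
  | succ n ih =>
    rw [grayRank, parity_startBits, Bool.toNat_true, pow_succ]
    omega

/-! ### Value gaps and their size under biased coins. -/

/-- The values of the two main states of level `i`: the decision state (`false`), which at level
`i + 1` copies one of the two states of level `i`, and the averaging state (`true`), which tosses
a coin of bias `q i` between them. -/
def pairValue (α : ℝ) (q : ℕ → ℝ) (b : ℕ → Bool) : ℕ → Bool → ℝ
  | 0, c => if c then 0 else α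
  | i + 1, false => pairValue α q b i (b i)
  | i + 1, true => q i * pairValue α q b i false + (1 - q i) * pairValue α q b i true

/-- The distance between the two values of level `i`. -/
def gap (α : ℝ) (q : ℕ → ℝ) (b : ℕ → Bool) : ℕ → ℝ
  | 0 => α
  | i + 1 => (if b i then q i else 1 - q i) * gap α q b i

/-- The averaging value lies between the two values below, so copying `false` keeps the sign of the
difference and copying `true` reverses it; the factor is the coin's probability of the state not
copied. -/
theorem pairValue_false_sub_true (α : ℝ) (q : ℕ → ℝ) (b : ℕ → Bool) (i : ℕ) :
    pairValue α q b i false - pairValue α q b i true =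
      (if parity b i then -1 else 1) * gap α q b i := by
  induction i with
  | zero => simp [pairValue, parity, gap]
  | succ i ih =>
    rw [pairValue, pairValue, parity, gap]
    have h : pairValue α q b i false =
      pairValue α q b i true + (if parity b i then -1 else 1) * gap α q b i := by linarith
    cases hb : b i <;> cases hp : parity b i <;> simp [h, hp] <;> ring

/-- Flipping bit `i` is profitable exactly if the parity of the first `i + 1` bits is odd. -/
theorem pairValue_not_sub (α : ℝ) (q : ℕ → ℝ) (b : ℕ → Bool) (i : ℕ) :
    pairValue α q b i (!b i) - pairValue α q b i (b i) =
      (if parity b (i + 1) then 1 else -1) * gap α q b i := by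
  have h := pairValue_false_sub_true α q b i
  rw [parity]
  cases hb : b i <;> cases hp : parity b i <;> simp [hp] at h ⊢ <;> linarith

theorem gap_bounds {α δ : ℝ} {q : ℕ → ℝ} (hα : 0 < α) (hδ : 0 ≤ δ) (hδ' : δ < 1)
    (hq : ∀ i, |q i - 1 / 2| ≤ δ / 2) (b : ℕ → Bool) (i : ℕ) :
    α * (1 / 2) ^ i * (1 - δ) ^ i ≤ gap α q b i ∧
      gap α q b i ≤ α * (1 / 2) ^ i * (1 + δ) ^ i := by
  induction i with
  | zero => simp [gap]
  | succ i ih =>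
    obtain ⟨h1, h2⟩ := abs_le.1 (hq i)
    have hf : (1 - δ) / 2 ≤ (if b i then q i else 1 - q i) ∧
        (if b i then q i else 1 - q i) ≤ (1 + δ) / 2 := by
      split_ifs <;> constructor <;> linarith
    have hpos : 0 ≤ α * (1 / 2) ^ i * (1 - δ) ^ i := by
      have : 0 ≤ 1 - δ := by linarith
      positivity
    rw [gap]
    constructor
    · calc _ = (1 - δ) / 2 * (α * (1 / 2) ^ i * (1 - δ) ^ i) := by ring
        _ ≤ _ := mul_le_mul hf.1 ih.1 hpos (by linarith [hf.1])
    · calc _ ≤ (1 + δ) / 2 * (α * (1 / 2) ^ i * (1 + δ) ^ i) :=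
            mul_le_mul hf.2 ih.2 (hpos.trans ih.1) (by linarith)
        _ = _ := by ring

/-- Only `k` factors are coins, but the error exponent is relaxed to `n` so that it is the same for
all levels. -/
theorem prod_bounds {δ : ℝ} (hδ : 0 ≤ δ) (hδ' : δ < 1) {f : ℕ → ℝ} {k n : ℕ} (hk : k ≤ n)
    (hf : ∀ j < k, |f j - 1 / 2| ≤ δ / 2) (hf' : ∀ j, k ≤ j → f j = 1) :
    (1 / 2) ^ k * (1 - δ) ^ n ≤ ∏ j ∈ Finset.range n, f j ∧
      ∏ j ∈ Finset.range n, f j ≤ (1 / 2) ^ k * (1 + δ) ^ n := by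
  have hprod : ∏ j ∈ Finset.range n, f j = ∏ j ∈ Finset.range k, f j := by
    symm
    refine Finset.prod_subset (Finset.range_mono hk) fun j _ hj => hf' j ?_
    simpa using hj
  have hlo : ∀ j ∈ Finset.range k, (1 - δ) / 2 ≤ f j := fun j hj => by
    have := (abs_le.1 (hf j (Finset.mem_range.1 hj))).1
    linarith
  have hhi : ∀ j ∈ Finset.range k, f j ≤ (1 + δ) / 2 := fun j hj => by
    have := (abs_le.1 (hf j (Finset.mem_range.1 hj))).2
    linarith
  have h1 : (0 : ℝ) ≤ (1 - δ) / 2 := by linarith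
  rw [hprod]
  constructor
  · calc _ ≤ (1 / 2 : ℝ) ^ k * (1 - δ) ^ k := by
          gcongr ?_ * ?_
          exact pow_le_pow_of_le_one (by linarith) (by linarith) hk
      _ = ∏ j ∈ Finset.range k, (1 - δ) / 2 := by
          rw [Finset.prod_const, Finset.card_range, ← mul_pow]; congr 1; ring
      _ ≤ _ := Finset.prod_le_prod (fun _ _ => h1) hlo
  · calc _ ≤ ∏ j ∈ Finset.range k, (1 + δ) / 2 :=
          Finset.prod_le_prod (fun j hj => h1.trans (hlo j hj)) hhi
      _ = (1 / 2 : ℝ) ^ k * (1 + δ) ^ k := by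
          rw [Finset.prod_const, Finset.card_range, ← mul_pow]; congr 1; ring
      _ ≤ _ := by
          gcongr ?_ * ?_
          exact pow_le_pow_right₀ (by linarith) hk

/-- With a slack of a factor two, higher levels have larger reduced costs. -/
theorem scaled_gap_lt {α δ : ℝ} {n i i' : ℕ} (hα : 0 < α) (hδ : 0 ≤ δ) (hδ' : δ < 1)
    (hn : (1 + δ) ^ (3 * n) < 2 * (1 - δ) ^ (3 * n)) (hi : i < i') (hi' : i' < n)
    {E E' W W' : ℝ}
    (hE : 0 ≤ E ∧ E ≤ (1 / 2) ^ (2 * (n - i)) * (1 + δ) ^ (2 * n))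
    (hW : 0 ≤ W ∧ W ≤ α * (1 / 2) ^ i * (1 + δ) ^ i)
    (hE' : (1 / 2) ^ (2 * (n - i')) * (1 - δ) ^ (2 * n) ≤ E')
    (hW' : α * (1 / 2) ^ i' * (1 - δ) ^ i' ≤ W') : E * W < E' * W' := by
  have h0 : 0 < 1 - δ := by linarith
  have hW2 : W ≤ α * (1 / 2) ^ i * (1 + δ) ^ n :=
    hW.2.trans (by gcongr; · linarith
                   · omega)
  have hW2' : α * (1 / 2) ^ i' * (1 - δ) ^ n ≤ W' := by
    refine le_trans ?_ hW'
    gcongr ?_ * ?_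
    exact pow_le_pow_of_le_one h0.le (by linarith) hi'.le
  -- The powers of one half combine to `2 * n - i`, so `i' > i` gains a factor of at least two. The
  -- error exponent `3 * n` consists of `2 * n` from the chain and `n` from the gap.
  have e1 : 2 * (n - i) + i = (2 * n - i') + (i' - i) := by omega
  have e2 : 2 * (n - i') + i' = 2 * n - i' := by omega
  have hhalf : (1 / 2 : ℝ) ^ (i' - i) ≤ 1 / 2 :=
    pow_le_of_le_one (by norm_num) (by norm_num) (by omega)
  calc E * W ≤ ((1 / 2) ^ (2 * (n - i)) * (1 + δ) ^ (2 * n)) * (α * (1 / 2) ^ i * (1 + δ) ^ n) :=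
        mul_le_mul hE.2 hW2 hW.1 (by positivity)
    _ = α * (1 / 2) ^ (2 * (n - i) + i) * (1 + δ) ^ (3 * n) := by ring
    _ = α * (1 / 2) ^ (2 * n - i') * ((1 / 2) ^ (i' - i) * (1 + δ) ^ (3 * n)) := by
        rw [e1, pow_add]; ring
    _ ≤ α * (1 / 2) ^ (2 * n - i') * (1 / 2 * (1 + δ) ^ (3 * n)) := by gcongr
    _ < α * (1 / 2) ^ (2 * n - i') * (1 - δ) ^ (3 * n) := by
        gcongr
        linarith
    _ = ((1 / 2) ^ (2 * (n - i')) * (1 - δ) ^ (2 * n)) * (α * (1 / 2) ^ i' * (1 - δ) ^ n) := by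
        rw [← e2, pow_add]; ring
    _ ≤ E' * W' := mul_le_mul hE' hW2' (by positivity) (le_trans (by positivity) hE')

end KleeMinty

/-! ### States, actions and policies of the construction. -/

namespace KleeMinty

/-- States: the main states `(i, c)` of the levels `0, …, n`, a chain of `2 * n` states for each
choice `c` at the decision state of level `i + 1`, and `p` idle states. -/
abbrev State (n p : ℕ) := (Fin (n + 1) × Bool) ⊕ (Fin n × Bool × Fin (2 * n)) ⊕ Fin p

/-- Actions: a default action for each state, and a second action for each decision state of
positive level. -/
abbrev Act (n p : ℕ) := State n p ⊕ Fin n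

variable {n p : ℕ}

/-- The state of the chain of `(i, c)` from which `j` steps remain. -/
def node (i : Fin n) (c : Bool) : ℕ → State n p
  | 0 => .inl (i.castSucc, c)
  | j + 1 => if h : j < 2 * n then .inr (.inl (i, c, ⟨j, h⟩)) else .inl (i.castSucc, c)

/-- The action at the decision state of level `i + 1` that leads to the state `(i, c)`. -/
def choice (i : Fin n) (c : Bool) : Act n p :=
  if c then .inr i else .inl (.inl (i.succ, false))

def source : Act n p → State n p
  | .inl s => s
  | .inr i => .inl (i.succ, false)

/-- The first of the two equally likely successors of an action; `none` is the sink. -/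
def target₁ : Act n p → Option (State n p)
  | .inl (.inl (i, c)) => Fin.cases none
      (fun k => some (if c then .inl (k.castSucc, false) else node k false (2 * n))) i
  | .inl (.inr (.inl (i, c, j))) => some (node i c j)
  | .inl (.inr (.inr _)) => none
  | .inr i => some (node i true (2 * n))

/-- The second of the two equally likely successors of an action: the first `2 * (n - i)` steps
of the chains of level `i` fall back to the decision state with probability one half. -/
def target₂ : Act n p → Option (State n p)
  | .inl (.inl (i, c)) => Fin.cases none
      (fun k => some (if c then .inl (k.castSucc, true) else node k false (2 * n))) i
  | .inl (.inr (.inl (i, c, j))) =>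
      some (if (j : ℕ) < 2 * (n - i) then .inl (i.succ, false) else node i c j)
  | .inl (.inr (.inr _)) => none
  | .inr i => some (node i true (2 * n))

/-- Only the decision state of level `0` pays a reward. -/
def pay : Act n p → ℝ
  | .inl (.inl (i, c)) => if i = 0 ∧ c = false then 1 else 0
  | _ => 0

/-- The policy given by the bits `b`. -/
def policy (b : ℕ → Bool) : State n p → Act n p
  | .inl (i, false) => Fin.cases (.inl (.inl (0, false))) (fun k => choice k (b k)) i
  | s => .inl s

theorem source_choice (i : Fin n) (c : Bool) :
    source (choice (p := p) i c) = .inl (i.succ, false) := by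
  cases c <;> rfl

theorem source_policy (b : ℕ → Bool) (s : State n p) : source (policy b s) = s := by
  rcases s with ⟨i, c⟩ | s
  · cases c
    · cases i using Fin.cases with
      | zero => rfl
      | succ k => exact source_choice k _
    · rfl
  · rfl

theorem target₁_choice (i : Fin n) (c : Bool) :
    target₁ (choice (p := p) i c) = some (node i c (2 * n)) := by
  cases c <;> rfl

theorem target₂_choice (i : Fin n) (c : Bool) :
    target₂ (choice (p := p) i c) = some (node i c (2 * n)) := by
  cases c <;> rfl

/-- Every action is either chosen by the policy `b`, or it is the unused choice at some level. -/
theorem eq_policy_or_eq_choice (b : ℕ → Bool) (a : Act n p) :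
    a = policy b (source a) ∨ ∃ i : Fin n, a = choice i (!b i) := by
  have hc : ∀ (i : Fin n) (c : Bool), (choice i c : Act n p) = policy b (.inl (i.succ, false)) ∨
      ∃ k : Fin n, (choice i c : Act n p) = choice k (!b k) := by
    intro i c
    by_cases h : c = b i
    · left; subst h; rfl
    · right; exact ⟨i, by rw [(Bool.eq_not.2 h)]⟩
  rcases a with (⟨i, c⟩ | s) | i
  · cases c
    · cases i using Fin.cases with
      | zero => left; rfl
      | succ k => exact hc k false
    · left; rfl
  · left; rfl
  · exact hc i true

theorem policy_flip (b : ℕ → Bool) (i : Fin n) :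
    (policy (flip b i) : State n p → Act n p) =
      Function.update (policy b) (.inl (i.succ, false)) (choice i (!b i)) := by
  funext s
  rcases s with ⟨k, c⟩ | s
  · cases c
    · cases k using Fin.cases with
      | zero =>
        rw [Function.update_of_ne (by simp [Fin.ext_iff])]
        rfl
      | succ k =>
        by_cases h : k = i
        · subst h
          rw [Function.update_self]
          simp [policy, flip]
        · rw [Function.update_of_ne (by simpa using h)]
          have : (k : ℕ) ≠ i := fun h' => h (Fin.ext h')
          simp [policy, flip, Function.update_of_ne this]
    · rw [Function.update_of_ne (by simp)]
      rfl
  · rw [Function.update_of_ne (by simp)]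
    rfl

/-- States closed under the first successors of some choices reach the sink. -/
theorem reach_induction {R : State n p → Prop} {π : State n p → Act n p}
    (hπ : ∀ s, source (π s) = s)
    (hnone : ∀ s, target₁ (π s) = none → R s)
    (hsome : ∀ s t, target₁ (π s) = some t → R t → R s) (s : State n p) : R s := by
  have hdef : ∀ s : State n p, (∀ i : Fin n, s ≠ .inl (i.succ, false)) → π s = .inl s := by
    intro s hs
    have := hπ s
    rcases h : π s with t | i
    · rw [h] at this
      exact congrArg _ this
    · rw [h] at this
      exact absurd this.symm (hs i)
  have hnode : ∀ (i : Fin n) (c : Bool), R (.inl (i.castSucc, c)) → ∀ j, R (node i c j) := by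
    intro i c h0 j
    induction j with
    | zero => exact h0
    | succ j ih =>
      rw [node]
      split_ifs with hj
      · refine hsome _ (node i c j) ?_ ih
        rw [hdef _ (by simp)]
        rfl
      · exact h0
  -- First successors never fall back: whatever the choice, they lead down one level at a time.
  have hmain : ∀ (i : ℕ) (hi : i < n + 1) (c : Bool), R (.inl (⟨i, hi⟩, c)) := by
    intro i
    induction i with
    | zero =>
      intro hi c
      refine hnone _ ?_
      rw [hdef _ (by simp [Fin.ext_iff])]
      rfl
    | succ k ih =>
      intro hi c
      have hk : k < n := by omega
      have ih' : ∀ c, R (.inl ((⟨k, hk⟩ : Fin n).castSucc, c)) := fun c => ih (by omega) c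
      cases c
      · have hs := hπ (.inl ((⟨k, hk⟩ : Fin n).succ, false))
        rcases h : π (.inl ((⟨k, hk⟩ : Fin n).succ, false)) with t | j
        · rw [h] at hs
          refine hsome _ (node ⟨k, hk⟩ false (2 * n)) ?_ (hnode _ _ (ih' _) _)
          rw [show (⟨k + 1, hi⟩ : Fin (n + 1)) = (⟨k, hk⟩ : Fin n).succ from rfl, h,
            show t = .inl ((⟨k, hk⟩ : Fin n).succ, false) from hs]
          rfl
        · rw [h] at hs
          have hj : j = ⟨k, hk⟩ := Fin.succ_injective _ (by simpa [source] using hs)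
          refine hsome _ (node ⟨k, hk⟩ true (2 * n)) ?_ (hnode _ _ (ih' _) _)
          rw [show (⟨k + 1, hi⟩ : Fin (n + 1)) = (⟨k, hk⟩ : Fin n).succ from rfl, h, hj]
          rfl
      · refine hsome _ (.inl ((⟨k, hk⟩ : Fin n).castSucc, false)) ?_ (ih' _)
        rw [hdef _ (by simp)]
        rfl
  rcases s with ⟨i, c⟩ | ⟨i, c, j⟩ | j
  · exact hmain i i.2 c
  · have := hnode i c (hmain i (by omega) c) (j + 1)
    rwa [node, dif_pos j.2] at this
  · refine hnone _ ?_
    rw [hdef _ (by simp)]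
    rfl

/-! ### Values and advantages under a policy. -/

section Values

variable (α : ℝ) (q : Act n p → ℝ) (b : ℕ → Bool)

/-- The biases of the averaging states. -/
noncomputable def bias (i : ℕ) : ℝ := if h : i < n then q (.inl (.inl ((⟨i, h⟩ : Fin n).succ, true))) else 1 / 2

/-- The probability of succeeding at a step of a chain. -/
noncomputable def stepProb (i : Fin n) (c : Bool) (j : ℕ) : ℝ :=
  if h : j < 2 * (n - i) then q (.inl (.inr (.inl (i, c, ⟨j, by omega⟩)))) else 1

/-- The probability of passing through the last `j` steps of a chain. -/
noncomputable def passProb (i : Fin n) (c : Bool) (j : ℕ) : ℝ := ∏ k ∈ Finset.range j, stepProb q i c k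

/-- The values of the states under the policy `b`. -/
noncomputable def value : State n p → ℝ
  | .inl (i, c) => pairValue α (bias q) b i c
  | .inr (.inl (i, c, j)) => pairValue α (bias q) b i (b i) +
      passProb q i c (j + 1) *
        (pairValue α (bias q) b i c - pairValue α (bias q) b i (b i))
  | .inr (.inr _) => 0

/-- A failed toss returns to the decision state, which is worth as much as `(i, b i)`; passing all
`j` remaining steps gives `(i, c)`. -/
theorem value_node (i : Fin n) (c : Bool) {j : ℕ} (hj : j ≤ 2 * n) :
    value α q b (node i c j) = pairValue α (bias q) b i (b i) +
      passProb q i c j * (pairValue α (bias q) b i c - pairValue α (bias q) b i (b i)) := by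
  cases j with
  | zero => simp [node, value, passProb]
  | succ j => rw [node, dif_pos (by omega), value]

/-- The one-step advantage of an action over the values of the policy `b`. -/
noncomputable def advantage (a : Act n p) : ℝ :=
  α * pay a + (q a * (target₁ a).elim 0 (value α q b) +
    (1 - q a) * (target₂ a).elim 0 (value α q b)) - value α q b (source a)

theorem advantage_choice (i : Fin n) (c : Bool) :
    advantage α q b (choice i c) = passProb q i c (2 * n) *
      (pairValue α (bias q) b i c - pairValue α (bias q) b i (b i)) := by
  have hpay : pay (choice (p := p) i c) = 0 := by
    cases c <;> simp [choice, pay]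
  rw [advantage, target₁_choice, target₂_choice, source_choice, hpay]
  simp only [Option.elim_some, value_node _ _ _ _ _ le_rfl]
  simp only [value, Fin.val_succ, pairValue]
  ring

/-- These are the Bellman equations identifying `value` as the value vector of the policy. On the
chosen chain the fallback value equals the goal value, so delays cost nothing. -/
theorem advantage_policy (s : State n p) : advantage α q b (policy b s) = 0 := by
  rcases s with ⟨i, c⟩ | ⟨i, c, j⟩ | j
  · cases c
    · cases i using Fin.cases with
      | zero => simp [advantage, policy, target₁, target₂, source, pay, value, pairValue]
      | succ k =>
        rw [show policy b (.inl (k.succ, false)) = (choice k (b k) : Act n p) from rfl,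
          advantage_choice, sub_self, mul_zero]
    · cases i using Fin.cases with
      | zero => simp [advantage, policy, target₁, target₂, source, pay, value, pairValue]
      | succ k => simp [advantage, policy, target₁, target₂, source, pay, value, pairValue, bias]
  · have hj : (j : ℕ) ≤ 2 * n := j.2.le
    simp only [advantage, policy, target₁, target₂, source, pay, Option.elim_some, mul_zero,
      zero_add]
    by_cases h : (j : ℕ) < 2 * (n - i)
    · rw [if_pos h, value_node _ _ _ _ _ hj]
      simp only [value, Fin.val_succ, pairValue, passProb, Finset.prod_range_succ]
      rw [stepProb, dif_pos h]
      ring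
    · rw [if_neg h, value_node _ _ _ _ _ hj]
      simp only [value, passProb, Finset.prod_range_succ]
      rw [stepProb, dif_neg h]
      ring
  · simp [advantage, policy, target₁, target₂, source, pay, value]

variable {α q}

theorem passProb_bounds {δ : ℝ} (hδ : 0 ≤ δ) (hδ' : δ < 1) (hq : ∀ a, |q a - 1 / 2| ≤ δ / 2)
    (i : Fin n) (c : Bool) :
    (1 / 2) ^ (2 * (n - i)) * (1 - δ) ^ (2 * n) ≤ passProb q i c (2 * n) ∧
      passProb q i c (2 * n) ≤ (1 / 2) ^ (2 * (n - i)) * (1 + δ) ^ (2 * n) := by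
  refine prod_bounds hδ hδ' (by omega) (fun j hj => ?_) fun j hj => ?_
  · rw [stepProb, dif_pos hj]
    exact hq _
  · rw [stepProb, dif_neg (by omega)]

/-- The default one half of `bias` beyond the last level provides the bound for all indices, as
`gap_bounds` requires. -/
theorem bias_sub_half_le {δ : ℝ} (hδ : 0 ≤ δ) (hq : ∀ a, |q a - 1 / 2| ≤ δ / 2) (i : ℕ) :
    |bias q i - 1 / 2| ≤ δ / 2 := by
  rw [bias]
  split_ifs
  · exact hq _
  · rw [sub_self, abs_zero]
    positivity

theorem gap_pos {δ : ℝ} (hα : 0 < α) (hδ : 0 ≤ δ) (hδ' : δ < 1)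
    (hq : ∀ a, |q a - 1 / 2| ≤ δ / 2) (i : ℕ) : 0 < gap α (bias q) b i := by
  have h0 : 0 < 1 - δ := by linarith
  exact lt_of_lt_of_le (by positivity) (gap_bounds hα hδ hδ' (bias_sub_half_le hδ hq) b i).1

theorem passProb_pos {δ : ℝ} (hδ : 0 ≤ δ) (hδ' : δ < 1) (hq : ∀ a, |q a - 1 / 2| ≤ δ / 2)
    (i : Fin n) (c : Bool) : 0 < passProb q i c (2 * n) := by
  have h0 : 0 < 1 - δ := by linarith
  exact lt_of_lt_of_le (by positivity) (passProb_bounds hδ hδ' hq i c).1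

theorem advantage_choice_not (i : Fin n) :
    advantage α q b (choice i (!b i)) = (if parity b (i + 1) then 1 else -1) *
      (passProb q i (!b i) (2 * n) * gap α (bias q) b i) := by
  rw [advantage_choice, pairValue_not_sub]
  ring

/-- Every action of positive advantage is an unused choice at a level of odd parity. -/
theorem exists_choice_of_advantage_pos {δ : ℝ} (hα : 0 < α) (hδ : 0 ≤ δ) (hδ' : δ < 1)
    (hq : ∀ a, |q a - 1 / 2| ≤ δ / 2) {a : Act n p} (ha : 0 < advantage α q b a) :
    ∃ i : Fin n, a = choice i (!b i) ∧ parity b (i + 1) = true := by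
  rcases eq_policy_or_eq_choice b a with h | ⟨i, rfl⟩
  · rw [h, advantage_policy] at ha
    exact absurd ha (lt_irrefl _)
  · refine ⟨i, rfl, ?_⟩
    by_contra h
    rw [advantage_choice_not, if_neg h] at ha
    have := mul_pos (passProb_pos hδ hδ' hq i (!b i)) (gap_pos b hα hδ hδ' hq i)
    linarith

theorem advantage_choice_lt {δ : ℝ} (hα : 0 < α) (hδ : 0 ≤ δ) (hδ' : δ < 1)
    (hn : (1 + δ) ^ (3 * n) < 2 * (1 - δ) ^ (3 * n))
    (hq : ∀ a, |q a - 1 / 2| ≤ δ / 2) {i i' : Fin n} (hi : i < i')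
    (h : parity b (i + 1) = true) (h' : parity b (i' + 1) = true) :
    advantage α q b (choice i (!b i)) < advantage α q b (choice i' (!b i')) := by
  rw [advantage_choice_not, advantage_choice_not, if_pos h, if_pos h', one_mul, one_mul]
  have hE := passProb_bounds hδ hδ' hq i (!b i)
  have hE' := passProb_bounds hδ hδ' hq i' (!b i')
  have hW := gap_bounds hα hδ hδ' (bias_sub_half_le hδ hq) b i
  have hW' := gap_bounds hα hδ hδ' (bias_sub_half_le hδ hq) b i'
  exact scaled_gap_lt hα hδ hδ' hn hi i'.2 ⟨(passProb_pos hδ hδ' hq i _).le, hE.2⟩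
    ⟨(gap_pos b hα hδ hδ' hq i).le, hW.2⟩ hE'.1 hW'.1

end Values

end KleeMinty

/-! ### The Dantzig path on perturbed processes. -/

namespace KleeMinty

variable {n p N m : ℕ}

/-- The numbering of the successor states. -/
def successor (e : State n p ≃ Fin N) : Option (State n p) → Fin (N + 1)
  | none => Fin.last N
  | some s => (e s).castSucc

/-- The decision process, for given numberings of the states and the actions. -/
noncomputable def mdp (e : State n p ≃ Fin N) (g : Act n p ≃ Fin m) : TotalRewardMDP N m :=
  TotalRewardMDP.coinFlip (fun a => e (source (g.symm a)))
    (fun s => ⟨g (.inl (e.symm s)), by simp [source]⟩)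
    (fun a => successor e (target₁ (g.symm a))) (fun a => successor e (target₂ (g.symm a)))
    (fun a => pay (g.symm a))

/-- The basis of the policy with bits `b`. -/
def basis (e : State n p ≃ Fin N) (g : Act n p ≃ Fin m) (b : ℕ → Bool) : Fin N → Fin m :=
  fun s => g (policy b (e.symm s))

variable {e : State n p ≃ Fin N} {g : Act n p ≃ Fin m}

theorem abs_reward_mdp_le (a : Fin m) : |(mdp e g).reward a| ≤ 1 := by
  change |pay (g.symm a)| ≤ 1
  rcases g.symm a with (⟨i, c⟩ | s) | i
  · rw [pay]
    split_ifs <;> simp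
  · simp [pay]
  · simp [pay]

theorem stopping_mdp : (mdp e g).Stopping := by
  intro π hπ u
  have hsrc : ∀ s, source (g.symm (π (e s))) = s := fun s => e.injective (hπ (e s))
  have hedge : ∀ s, (mdp e g).Edge π (e s).castSucc
      (successor e (target₁ (g.symm (π (e s))))) := by
    intro s
    refine ⟨e s, rfl, ?_⟩
    simp only [mdp, TotalRewardMDP.coinFlip, if_true]
    split_ifs <;> norm_num
  have key : ∀ s, Relation.ReflTransGen ((mdp e g).Edge π) (e s).castSucc (Fin.last N) := by
    refine reach_induction hsrc (fun s hs => ?_) (fun s t hst ht => ?_)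
    · have := hedge s
      rw [hs] at this
      exact .single this
    · have := hedge s
      rw [hst] at this
      exact .head this ht
  cases u using Fin.lastCases with
  | last => exact .refl
  | cast s => simpa using key (e.symm s)

theorem isPolicy_basis {M : TotalRewardMDP N m} (hM : M.src = (mdp e g).src) (b : ℕ → Bool) :
    M.IsPolicy (basis e g b) := by
  intro s
  rw [hM]
  simp [mdp, TotalRewardMDP.coinFlip, basis, source_policy]

theorem basis_flip (b : ℕ → Bool) (i : Fin n) : basis e g (flip b i) =
    Function.update (basis e g b) ((mdp e g).src (g (choice i (!b i)))) (g (choice i (!b i))) := by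
  funext s
  have hs : (mdp e g).src (g (choice i (!b i))) = e (.inl (i.succ, false)) := by
    simp [mdp, TotalRewardMDP.coinFlip, source_choice]
  rw [hs, basis, policy_flip]
  by_cases h : s = e (.inl (i.succ, false))
  · subst h; simp
  · rw [Function.update_of_ne h, Function.update_of_ne (fun h' => h (by simp [← h'])), basis]

section Perturbed

variable {σ : ℝ} {M' : TotalRewardMDP N m}

theorem reward_of_isPerturbation (h : (mdp e g).IsPerturbation σ M') (a : Act n p) :
    M'.reward (g a) = M'.reward (g (.inl (.inl (0, false)))) * pay a := by
  have hz : pay a = 0 → M'.reward (g a) = 0 := fun ha =>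
    h.reward_zero _ (by simpa [mdp, TotalRewardMDP.coinFlip] using ha)
  rcases a with (⟨i, c⟩ | s) | i
  · by_cases hic : i = 0 ∧ c = false
    · obtain ⟨rfl, rfl⟩ := hic
      simp [pay]
    · have hp : pay (.inl (.inl (i, c)) : Act n p) = 0 := by rw [pay, if_neg hic]
      rw [hz hp, hp, mul_zero]
  · rw [hz rfl]; simp [pay]
  · rw [hz rfl]; simp [pay]

/-- Reduced costs of the perturbed linear program. -/
theorem exists_reducedCost_eq (hσ : 0 ≤ σ) (hM' : M'.Stopping)
    (h : (mdp e g).IsPerturbation σ M') : ∃ (α : ℝ) (q : Act n p → ℝ), 1 - σ ≤ α ∧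
      (∀ a, |q a - 1 / 2| ≤ σ) ∧
      ∀ b a, M'.lp.reducedCost (basis e g b) (g a) = advantage α q b a := by
  choose q hq hf using TotalRewardMDP.exists_bias_of_isPerturbation hσ h
  refine ⟨M'.reward (g (.inl (.inl (0, false)))), fun a => q (g a), ?_, fun a => hq _, ?_⟩
  · have h1 := h.reward_close (g (.inl (.inl (0, false))))
    have h2 : (mdp e g).reward (g (.inl (.inl (0, false)))) = 1 := by
      simp [mdp, TotalRewardMDP.coinFlip, pay]
    rw [h2] at h1
    linarith [(abs_le.1 h1).1]
  intro b
  set α := M'.reward (g (.inl (.inl (0, false)))) with hα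
  -- By the Bellman equations `v` is the dual solution of the basis, so reduced costs are
  -- advantages.
  set v : Fin N → ℝ := fun s => value α (fun a => q (g a)) b (e.symm s) with hv
  have hsucc : ∀ o, Fin.snoc (α := fun _ => ℝ) v 0 (successor e o) =
      o.elim 0 (value α (fun a => q (g a)) b) := by
    intro o
    cases o with
    | none => simp [successor]
    | some s => simp [successor, hv]
  have hadv : ∀ a, M'.lp.rhs (g a) - (M'.lp.mat *ᵥ v) (g a) =
      advantage α (fun a => q (g a)) b a := by
    intro a
    rw [TotalRewardMDP.lp_mulVec, hf, h.src_eq, hsucc, hsucc]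
    have hr : M'.lp.rhs (g a) = α * pay a := reward_of_isPerturbation h a
    rw [hr, advantage]
    simp [hv, mdp, TotalRewardMDP.coinFlip]
    ring
  intro a
  rw [← hadv]
  refine InequalityLP.reducedCost_eq _
    (TotalRewardMDP.isUnit_det_basisMatrix hM' (isPolicy_basis h.src_eq b)) (fun r => ?_) _
  have := hadv (policy b (e.symm r))
  rw [advantage_policy] at this
  exact (sub_eq_zero.1 this).symm

/-- Every run from the largest bits on a perturbed program visits all bit vectors. -/
theorem two_pow_le_of_isRun {δ : ℝ} (hδ : 0 ≤ δ) (hδ' : δ < 1)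
    (hn : (1 + δ) ^ (3 * n) < 2 * (1 - δ) ^ (3 * n))
    (h : (mdp e g).IsPerturbation (δ / 2) M') {k : ℕ} {β : ℕ → Fin N → Fin m}
    (hrun : M'.lp.IsRun (basis e g startBits) k β) : 2 ^ n ≤ k + 1 := by
  have hσ : 0 ≤ δ / 2 := by linarith
  have hM' : M'.Stopping :=
    TotalRewardMDP.stopping_of_isPerturbation_coinFlip hσ (by linarith) stopping_mdp h
  obtain ⟨α, q, hα, hq, hred⟩ := exists_reducedCost_eq hσ hM' h
  have hα0 : 0 < α := by linarith
  obtain ⟨h0, hstep, hhalt⟩ := hrun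
  -- Each pivot lowers the Gray rank by exactly one, starting from `2 ^ n - 1`; halting forces rank
  -- zero.
  have hinv : ∀ i ≤ k, ∃ b, β i = basis e g b ∧ 2 ^ n ≤ grayRank b n + i + 1 := by
    intro i
    induction i with
    | zero => exact fun _ => ⟨startBits, h0, (grayRank_startBits n).ge⟩
    | succ i ih =>
      intro hi
      obtain ⟨b, hb, hrank⟩ := ih (by omega)
      have hpivot := hstep i (by omega)
      rw [hb] at hpivot
      obtain ⟨j, ⟨hpos, hmax⟩, heq⟩ :=
        TotalRewardMDP.eq_update_of_dantzigPivot hM' (isPolicy_basis h.src_eq b) hpivot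
      obtain ⟨a, rfl⟩ := g.surjective j
      rw [hred] at hpos
      obtain ⟨l, rfl, hl⟩ := exists_choice_of_advantage_pos b hα0 hδ hδ' hq hpos
      refine ⟨flip b l, ?_, ?_⟩
      · rw [heq, basis_flip, h.src_eq]
      -- A higher level of odd parity would have a larger reduced cost, against Dantzig's choice.
      · have hlast : ∀ l', (l : ℕ) < l' → l' < n → parity b (l' + 1) = false := by
          intro l' hl' hl'n
          by_contra hp
          have h1 := hmax (g (choice ⟨l', hl'n⟩ (!b l')))
          rw [hred, hred] at h1
          exact absurd h1 (not_le.2 (advantage_choice_lt b hα0 hδ hδ' hn hq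
            (i := l) (i' := ⟨l', hl'n⟩) hl' hl (by simpa using hp)))
        have := grayRank_flip b l.2 hl hlast
        omega
  obtain ⟨b, hb, hrank⟩ := hinv k le_rfl
  rw [hb] at hhalt
  have hopt := TotalRewardMDP.reducedCost_nonpos_of_halts hM' (isPolicy_basis h.src_eq b) hhalt
  have hzero : grayRank b n = 0 := by
    refine grayRank_eq_zero fun i hi => ?_
    by_contra hp
    have h1 := hopt (g (choice ⟨i, hi⟩ (!b i)))
    rw [hred] at h1
    have h2 := advantage_choice_not (α := α) (q := q) b ⟨i, hi⟩
    simp only [Bool.not_eq_false] at hp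
    rw [if_pos hp, one_mul] at h2
    have h3 := mul_pos (passProb_pos hδ hδ' hq ⟨i, hi⟩ (!b i)) (gap_pos b hα0 hδ hδ' hq i)
    simp only at h2
    linarith
  omega

end Perturbed

/-- Small relative errors accumulate to at most a factor of two. -/
theorem one_add_pow_lt_two_mul {δ : ℝ} {k : ℕ} (hδ : 0 ≤ δ) (hδ' : δ < 1)
    (hk : k * δ ≤ 1 / 4) : (1 + δ) ^ k < 2 * (1 - δ) ^ k := by
  have h1 : 3 / 4 ≤ (1 - δ) ^ k := by
    have := one_add_mul_le_pow (a := -δ) (by linarith) k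
    rw [← sub_eq_add_neg] at this
    linarith
  -- Together with Bernoulli's bound this gives `(1 + δ) ^ k ≤ 4 / 3 < 3 / 2`.
  have h2 : (1 + δ) ^ k * (1 - δ) ^ k ≤ 1 := by
    rw [← mul_pow]
    exact pow_le_one₀ (by nlinarith) (by nlinarith)
  have h3 : 0 ≤ (1 + δ) ^ k := by positivity
  nlinarith

end KleeMinty

/-! ### Choice of parameters and conclusion. -/

open KleeMinty

theorem mainTheorem9 :
    ∃ C c : ℝ, 0 < C ∧ 0 < c ∧ ∀ K : ℝ, 0 < K → ∃ N₀ : ℕ, ∀ N : ℕ, N₀ ≤ N →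
      ∃ (m : ℕ) (M : TotalRewardMDP N m) (β₀ : Fin N → Fin m),
        (m : ℝ) ≤ C * N ∧ M.Stopping ∧ (∀ a, |M.reward a| ≤ 1) ∧
        (∀ M' : TotalRewardMDP N m, M.IsPerturbation (K / N) M' →
          M'.lp.IsFeasibleBasis β₀ ∧
          ENNReal.ofReal (2 ^ (c * √(N : ℝ))) ≤ (M'.lp.pivotCount β₀ : ℝ≥0∞)) ∧
        (∀ (Ω : Type) [MeasurableSpace Ω] (μ : MeasureTheory.Measure Ω)
          [MeasureTheory.IsProbabilityMeasure μ] (X : Ω → TotalRewardMDP N m),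
          (∀ᵐ ω ∂μ, M.IsPerturbation (K / N) (X ω)) →
          ENNReal.ofReal (2 ^ (c * √(N : ℝ))) ≤
            ∫⁻ ω, ((X ω).lp.pivotCount β₀ : ℝ≥0∞) ∂μ) := by
  -- `N ≥ 256` gives `n ≥ 4`, hence `√N / 8 ≤ (n + 1) / 2 ≤ n - 1`. `N ≥ 36 * K ^ 2` gives `6 * K ≤
  -- √N`, which with `4 * n ≤ √N` yields `3 * n * δ ≤ 1 / 4`.
  refine ⟨2, 1 / 8, by norm_num, by norm_num, fun K hK =>
    ⟨max 256 ⌈36 * K ^ 2⌉₊, fun N hN => ?_⟩⟩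
  have hN1 : 256 ≤ N := (le_max_left _ _).trans hN
  have hN2 : 36 * K ^ 2 ≤ N := (Nat.le_ceil _).trans (by exact_mod_cast (le_max_right _ _).trans hN)
  set n := Nat.sqrt N / 4 with hn
  have hsq : Nat.sqrt N * Nat.sqrt N ≤ N := Nat.sqrt_le N
  have h16 : 16 ≤ Nat.sqrt N := Nat.le_sqrt.2 hN1
  have hn4 : 4 * n ≤ Nat.sqrt N := by omega
  have hn1 : 4 ≤ n := by omega
  have hnn : 16 * (n * n) ≤ N := by nlinarith
  -- Idle states fill up the count to exactly `N`.
  have hcard : Fintype.card (State n (N - (2 * (n + 1) + 4 * (n * n)))) = N := by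
    have h1 : 2 * (n + 1) + 4 * (n * n) ≤ N := by nlinarith
    simp only [Fintype.card_sum, Fintype.card_prod, Fintype.card_fin, Fintype.card_bool]
    have h2 : n * (2 * (2 * n)) = 4 * (n * n) := by ring
    rw [h2]
    omega
  have hcard' : Fintype.card (Act n (N - (2 * (n + 1) + 4 * (n * n)))) = N + n := by
    rw [Fintype.card_sum, hcard, Fintype.card_fin]
  let e := Fintype.equivFinOfCardEq hcard
  let g := Fintype.equivFinOfCardEq hcard'
  have hNpos : (0 : ℝ) < N := by exact_mod_cast (by omega : 0 < N)
  have hs0 : 0 < √(N : ℝ) := Real.sqrt_pos.2 hNpos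
  have hss : √(N : ℝ) * √(N : ℝ) = N := Real.mul_self_sqrt hNpos.le
  have hsn : 4 * (n : ℝ) ≤ √(N : ℝ) :=
    le_trans (by exact_mod_cast hn4) (Real.nat_sqrt_le_real_sqrt)
  have hsn' : √(N : ℝ) ≤ 4 * n + 4 := by
    refine (Real.real_sqrt_le_nat_sqrt_succ).trans ?_
    have : Nat.sqrt N + 1 ≤ 4 * n + 4 := by omega
    exact_mod_cast this
  have hsK : 6 * K ≤ √(N : ℝ) := Real.le_sqrt_of_sq_le (by linarith [mul_pow 6 K 2])
  set δ : ℝ := 2 * (K / N) with hδdef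
  have hδ : 0 ≤ δ := by positivity
  have hδn : ((3 * n : ℕ) : ℝ) * δ ≤ 1 / 4 := by
    rw [hδdef, ← mul_assoc, ← mul_div_assoc, div_le_iff₀ hNpos]
    push_cast
    have : (4 * n : ℝ) * (6 * K) ≤ √(N : ℝ) * √(N : ℝ) :=
      mul_le_mul hsn hsK (by positivity) hs0.le
    linarith
  have hn1' : (4 : ℝ) ≤ n := by exact_mod_cast hn1
  have hδ' : δ < 1 := by
    push_cast at hδn
    nlinarith
  have hpow := one_add_pow_lt_two_mul hδ hδ' hδn
  have hσ : K / N = δ / 2 := by rw [hδdef]; ring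
  have hpivots : ∀ M' : TotalRewardMDP N (N + n), (mdp e g).IsPerturbation (K / N) M' →
      ENNReal.ofReal (2 ^ (1 / 8 * √(N : ℝ))) ≤
        (M'.lp.pivotCount (basis e g startBits) : ℝ≥0∞) := by
    intro M' h
    rw [hσ] at h
    have h1 : ((2 ^ n - 1 : ℕ) : ℕ∞) ≤ M'.lp.pivotCount (basis e g startBits) := by
      refine le_iInf₂ fun k hk => ?_
      obtain ⟨β, hβ⟩ := hk
      have := two_pow_le_of_isRun hδ hδ' hpow h hβ
      exact_mod_cast (by omega : 2 ^ n - 1 ≤ k)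
    have h2 : (2 : ℝ) ^ (1 / 8 * √(N : ℝ)) ≤ ((2 ^ n - 1 : ℕ) : ℝ) := by
      have h3 : 2 ^ (n - 1) ≤ 2 ^ n - 1 := by
        obtain ⟨k, hk⟩ : ∃ k, n = k + 1 := ⟨n - 1, by omega⟩
        have := Nat.one_le_two_pow (n := k)
        rw [hk, Nat.add_sub_cancel, pow_succ]
        omega
      calc (2 : ℝ) ^ (1 / 8 * √(N : ℝ)) ≤ (2 : ℝ) ^ ((n - 1 : ℕ) : ℝ) := by
            refine Real.rpow_le_rpow_of_exponent_le (by norm_num) ?_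
            rw [Nat.cast_sub (by omega), Nat.cast_one]
            linarith
        _ = ((2 ^ (n - 1) : ℕ) : ℝ) := by rw [Real.rpow_natCast]; push_cast; rfl
        _ ≤ _ := by exact_mod_cast h3
    calc ENNReal.ofReal (2 ^ (1 / 8 * √(N : ℝ))) ≤ ENNReal.ofReal ((2 ^ n - 1 : ℕ) : ℝ) :=
          ENNReal.ofReal_le_ofReal h2
      _ = (((2 ^ n - 1 : ℕ) : ℕ∞) : ℝ≥0∞) := by
          rw [ENNReal.ofReal_natCast, ENat.toENNReal_coe]
      _ ≤ _ := ENat.toENNReal_le.2 h1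
  refine ⟨N + n, mdp e g, basis e g startBits, ?_, stopping_mdp, abs_reward_mdp_le,
    fun M' h => ⟨?_, hpivots M' h⟩, ?_⟩
  · have : n ≤ N := by nlinarith
    exact_mod_cast (by omega : N + n ≤ 2 * N)
  · have hσ0 : 0 ≤ K / N := by positivity
    exact TotalRewardMDP.isFeasibleBasis (TotalRewardMDP.stopping_of_isPerturbation_coinFlip hσ0
      (by linarith) stopping_mdp h) (isPolicy_basis h.src_eq _)
  · intro Ω _ μ _ X hX
    calc ENNReal.ofReal (2 ^ (1 / 8 * √(N : ℝ))) =
          ∫⁻ _, ENNReal.ofReal (2 ^ (1 / 8 * √(N : ℝ))) ∂μ := by simp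
      _ ≤ _ := MeasureTheory.lintegral_mono_ae (hX.mono fun ω hω => hpivots _ hω)
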